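/- Let $\mathbb S=\{I\in\mathbb H: I^2=-1\}$, let $D\subset\mathbb C$ be an open set with $\overline D=D$ (invariance under complex conjugation), and let $\Omega_D=\{\alpha+I\beta:\alpha,\beta\in\mathbb R,\ \alpha+i\beta\in D,\ I\in\mathbb S\}\subset\mathbb H$. Let $f:\Omega_D\to\mathbb H$ be slice regular, i.e. $f(\alpha+I\beta)=F_0(\alpha+i\beta)+I\,F_1(\alpha+i\beta)$ for a (necessarily unique) function $F=F_0+\sqrt{-1}F_1:D\to\mathbb H\otimes_{\mathbb R}\mathbb C$ of class $C^1$ with $F(\bar z)=\overline{F(z)}$ and $\partial F/\partial\bar z=\tfrac12(\partial_\alpha+\sqrt{-1}\,\partial_\beta)F=0$ on $D$. Its slice derivative $\partial_cf:\Omega_D\to\mathbb H$ is the function induced in the same way by $\partial F/\partial z=\tfrac12(\partial_\alpha-\sqrt{-1}\,\partial_\beta)F$. Let $q_0\in\Omega_D\setminus\mathbb R$, write ${\sf Im}(q_0)=(q_0-q_0^c)/2$, where $q_0^c$ is the conjugate of $q_0$, and let $\Delta_{q_0}(x)=x^2-x(q_0+q_0^c)+q_0q_0^c$. A sequence $(s_n)_{n\ge0}$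 in $\mathbb H$ is called a sequence of spherical coefficients at $q_0$ of a function $g:\Omega_D\to\mathbb H$ if there is $R>0$ such that $U(q_0,R)=\{x\in\mathbb H:|\Delta_{q_0}(x)|<R^2\}\subset\Omega_D$ and $$g(x)=\sum_{n\ge0}\Delta_{q_0}(x)^n\,[\,s_{2n}+(x-q_0)s_{2n+1}\,]\qquad\text{for all }x\in U(q_0,R),$$ the series being absolutely convergent. Theorem 5.1. The function $f$ has exactly one sequence $(s_n)$ of spherical coefficients at $q_0$, its slice derivative $\partial_cf$ has exactly one sequence $(s'_n)$ of spherical coefficients at $q_0$, and for every integer $k\ge0$ $$s'_{2k}=(2k+1)\,s_{2k+1}+2(k+1)\,{\sf Im}(q_0)\,s_{2k+2},\qquad s'_{2k+1}=(2k+2)\,s_{2k+2}-2(k+1)\,{\sf Im}(q_0)\,s_{2k+3}.$$ -/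

import Mathlib

open scoped Quaternion

namespace SliceRegular

noncomputable section

/-- The sphere of imaginary units of the quaternions. -/
def imagUnits : Set ℍ[ℝ] := {I | I ^ 2 = -1}

/-- The circularization `Ω_D` of `D ⊆ ℂ`: all `α + I β` with `α + i β ∈ D` and `I` an
imaginary unit. -/
def circularization (D : Set ℂ) : Set ℍ[ℝ] :=
  {x | ∃ (α β : ℝ) (I : ℍ[ℝ]), I ∈ imagUnits ∧ (⟨α, β⟩ : ℂ) ∈ D ∧ x = (α : ℍ[ℝ]) + I * (β : ℍ[ℝ])}

/-- `D` is invariant under complex conjugation. -/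
def ConjInvariant (D : Set ℂ) : Prop := ∀ z ∈ D, starRingEnd ℂ z ∈ D

/-- The complexified quaternions `ℍ ⊗ ℂ = {a + √-1 b | a, b ∈ ℍ}`, with `a + √-1 b` written
as the pair `(a, b)`. -/
abbrev HC : Type := ℍ[ℝ] × ℍ[ℝ]

/-- Multiplication by `√-1` on `ℍ ⊗ ℂ`. -/
def HC.mulI (w : HC) : HC := (-w.2, w.1)

/-- The conjugation `a + √-1 b ↦ a - √-1 b` on `ℍ ⊗ ℂ`. -/
def HC.conj (w : HC) : HC := (w.1, -w.2)

/-- `F : D → ℍ ⊗ ℂ` is a stem function (values outside `D` are irrelevant). -/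
def IsStemOn (D : Set ℂ) (F : ℂ → HC) : Prop :=
  ∀ z ∈ D, F (starRingEnd ℂ z) = HC.conj (F z)

/-- The function `f` is, on `Ω_D`, the slice function induced by `F = F₀ + √-1 F₁`, that is
`f (α + I β) = F₀ (α + i β) + I F₁ (α + i β)`. -/
def InducesOn (D : Set ℂ) (F : ℂ → HC) (f : ℍ[ℝ] → ℍ[ℝ]) : Prop :=
  ∀ (α β : ℝ) (I : ℍ[ℝ]), I ∈ imagUnits → (⟨α, β⟩ : ℂ) ∈ D →
    f ((α : ℍ[ℝ]) + I * (β : ℍ[ℝ])) = (F ⟨α, β⟩).1 + I * (F ⟨α, β⟩).2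

/-- The slice function `ℐ(F)`, evaluated at `x` through the representation `x = α + I β` with
`α = Re x`, `β = |Im x|`, `I = Im x / |Im x|`. (At a real point `F₁` vanishes for a stem function,
and the term `I F₁` is `0`.) -/
def induced (F : ℂ → HC) (x : ℍ[ℝ]) : ℍ[ℝ] :=
  (F ⟨x.re, ‖x.im‖⟩).1 + (‖x.im‖⁻¹ • x.im) * (F ⟨x.re, ‖x.im‖⟩).2

/-- `∂F/∂z = ½ (∂F/∂α - √-1 ∂F/∂β)`. -/
def dz (F : ℂ → HC) (z : ℂ) : HC :=
  (2⁻¹ : ℝ) • (fderiv ℝ F z 1 - HC.mulI (fderiv ℝ F z Complex.I))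

/-- `∂F/∂z̄ = ½ (∂F/∂α + √-1 ∂F/∂β)`. -/
def dzbar (F : ℂ → HC) (z : ℂ) : HC :=
  (2⁻¹ : ℝ) • (fderiv ℝ F z 1 + HC.mulI (fderiv ℝ F z Complex.I))

/-- `F` is holomorphic on the open set `D`, for the complex structure on `ℍ ⊗ ℂ` given by
multiplication by `√-1`. -/
def HolomorphicOn (D : Set ℂ) (F : ℂ → HC) : Prop :=
  ContDiffOn ℝ 1 F D ∧ ∀ z ∈ D, dzbar F z = 0

/-- `f` is slice regular on `Ω_D`: it is induced by a holomorphic stem function on `D`. -/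
def IsSliceRegularOn (D : Set ℂ) (f : ℍ[ℝ] → ℍ[ℝ]) : Prop :=
  ∃ F : ℂ → HC, IsStemOn D F ∧ InducesOn D F f ∧ HolomorphicOn D F

open Classical in
/-- The stem function of a slice function `f` on `Ω_D`; it is determined on `D` by `f`, see
`stem_unique`. -/
def stem (D : Set ℂ) (f : ℍ[ℝ] → ℍ[ℝ]) : ℂ → HC :=
  if h : ∃ F : ℂ → HC, IsStemOn D F ∧ InducesOn D F f then h.choose else 0

/-- The slice derivative `∂_c f = ℐ(∂F/∂z)` of the slice function `f = ℐ(F)` on `Ω_D`. -/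
def sliceDeriv (D : Set ℂ) (f : ℍ[ℝ] → ℍ[ℝ]) : ℍ[ℝ] → ℍ[ℝ] := induced (dz (stem D f))

/-- The characteristic polynomial `Δ_{q₀}(x) = x² - x (q₀ + q₀ᶜ) + q₀ q₀ᶜ`. -/
def charPoly (q₀ x : ℍ[ℝ]) : ℍ[ℝ] := x ^ 2 - x * (q₀ + star q₀) + q₀ * star q₀

/-- The Cassini ball `U(q₀, R)`. -/
def cassiniBall (q₀ : ℍ[ℝ]) (R : ℝ) : Set ℍ[ℝ] := {x | ‖charPoly q₀ x‖ < R ^ 2}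

/-- `s` is a sequence of spherical coefficients of `f : Ω → ℍ` at `q₀`: on some Cassini ball
contained in `Ω`, `f (x) = ∑ₙ Δ_{q₀}(x)ⁿ (s₂ₙ + (x - q₀) s₂ₙ₊₁)`. -/
def IsSphericalCoeffs (Ω : Set ℍ[ℝ]) (f : ℍ[ℝ] → ℍ[ℝ]) (q₀ : ℍ[ℝ]) (s : ℕ → ℍ[ℝ]) : Prop :=
  ∃ R : ℝ, 0 < R ∧ cassiniBall q₀ R ⊆ Ω ∧ ∀ x ∈ cassiniBall q₀ R,
    HasSum (fun n : ℕ => charPoly q₀ x ^ n * (s (2 * n) + (x - q₀) * s (2 * n + 1))) (f x)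

theorem mul_self_of_mem {I : ℍ[ℝ]} (hI : I ∈ imagUnits) : I * I = -1 :=
  (pow_two I).symm.trans hI

/-- The quaternion `i` is an imaginary unit. -/
theorem i_mem_imagUnits : (⟨0, 1, 0, 0⟩ : ℍ[ℝ]) ∈ imagUnits := by
  have h : ∀ J : ℍ[ℝ], J.re = 0 → J.imI = 1 → J.imJ = 0 → J.imK = 0 → J ∈ imagUnits := by
    intro J h0 h1 h2 h3
    refine (pow_two J).trans ?_
    apply Quaternion.ext <;> simp [h0, h1, h2, h3]
  exact h _ rfl rfl rfl rfl

theorem neg_mem_imagUnits {I : ℍ[ℝ]} (hI : I ∈ imagUnits) : -I ∈ imagUnits :=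
  (neg_sq I).trans hI

/-- A slice function has only one stem function on `D`. -/
theorem stem_unique {D : Set ℂ} {F G : ℂ → HC} {f : ℍ[ℝ] → ℍ[ℝ]}
    (hF : InducesOn D F f) (hG : InducesOn D G f) : Set.EqOn F G D := by
  rintro ⟨α, β⟩ hz
  obtain ⟨I, hi⟩ : ∃ I : ℍ[ℝ], I ∈ imagUnits := ⟨_, i_mem_imagUnits⟩
  have h₁ := (hF α β I hi hz).symm.trans (hG α β I hi hz)
  have hn := neg_mem_imagUnits hi
  have h₂ := (hF α β (-I) hn hz).symm.trans (hG α β (-I) hn hz)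
  have hII := mul_self_of_mem hi
  generalize F ⟨α, β⟩ = a at *
  generalize G ⟨α, β⟩ = b at *
  have e₁ : a.1 = b.1 := by
    have h : (2 : ℝ) • a.1 = (2 : ℝ) • b.1 := by
      have h := congrArg₂ (· + ·) h₁ h₂
      simp only [neg_mul] at h
      rw [two_smul, two_smul]
      calc a.1 + a.1 = a.1 + I * a.2 + (a.1 + -(I * a.2)) := by abel
        _ = b.1 + I * b.2 + (b.1 + -(I * b.2)) := h
        _ = b.1 + b.1 := by abel
    exact smul_right_injective _ (two_ne_zero) h
  rw [e₁, add_right_inj] at h₁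
  have e₂ : a.2 = b.2 := by
    have h := congrArg (fun y => I * y) h₁
    simp only [← mul_assoc, hII, neg_mul, one_mul, neg_inj] at h
    exact h
  exact Prod.ext e₁ e₂

/-- On `Ω_D`, `induced F` is the slice function induced by the stem function `F`. -/
theorem inducesOn_induced {D : Set ℂ} {F : ℂ → HC} (hF : IsStemOn D F) :
    InducesOn D F (induced F) := by
  intro α β I hI hz
  have hII := mul_self_of_mem hI
  have hns : ‖I‖ = 1 := by
    have h := congrArg norm hII
    rw [norm_mul, norm_neg, norm_one] at h
    nlinarith [norm_nonneg I]
  have hre : I.re = 0 := by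
    have h0 := congrArg QuaternionAlgebra.re hII
    have h1 := congrArg QuaternionAlgebra.imI hII
    have h2 := congrArg QuaternionAlgebra.imJ hII
    have h3 := congrArg QuaternionAlgebra.imK hII
    simp only [Quaternion.re_mul, Quaternion.imI_mul, Quaternion.imJ_mul, Quaternion.imK_mul,
      Quaternion.re_neg, Quaternion.imI_neg, Quaternion.imJ_neg, Quaternion.imK_neg,
      Quaternion.re_one, Quaternion.imI_one, Quaternion.imJ_one, Quaternion.imK_one] at h0 h1 h2 h3
    by_contra hne
    have e1 : I.imI = 0 := by
      apply mul_left_cancel₀ hne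
      linarith
    have e2 : I.imJ = 0 := by
      apply mul_left_cancel₀ hne
      linarith
    have e3 : I.imK = 0 := by
      apply mul_left_cancel₀ hne
      linarith
    rw [e1, e2, e3] at h0
    nlinarith [mul_self_nonneg I.re]
  have hxre : ((α : ℍ[ℝ]) + I * (β : ℍ[ℝ])).re = α := by
    simp [Quaternion.re_mul, hre]
  have hxim : ((α : ℍ[ℝ]) + I * (β : ℍ[ℝ])).im = β • I := by
    rw [← Quaternion.coe_commutes, Quaternion.coe_mul_eq_smul]
    apply Quaternion.ext <;> simp [hre]
  have hnx : ‖β • I‖ = |β| := by rw [norm_smul, hns, mul_one, Real.norm_eq_abs]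
  unfold induced
  rw [hxre, hxim, hnx, smul_smul]
  rcases lt_trichotomy β 0 with hβ | hβ | hβ
  · have h := hF _ hz
    have hc : starRingEnd ℂ ⟨α, β⟩ = ⟨α, -β⟩ := rfl
    rw [hc] at h
    rw [abs_of_neg hβ, h, inv_neg, neg_mul, inv_mul_cancel₀ hβ.ne]
    simp [HC.conj]
  · subst hβ
    have h := hF _ hz
    have hc : starRingEnd ℂ ⟨α, 0⟩ = ⟨α, 0⟩ := by
      apply Complex.ext <;> simp
    rw [hc] at h
    have h2 : (F ⟨α, 0⟩).2 = -(F ⟨α, 0⟩).2 := congrArg Prod.snd h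
    have h3 : (F ⟨α, 0⟩).2 = 0 := by
      have h4 : (2 : ℝ) • (F ⟨α, 0⟩).2 = 0 := by
        rw [two_smul]
        exact eq_neg_iff_add_eq_zero.mp h2
      exact (smul_eq_zero.mp h4).resolve_left two_ne_zero
    rw [abs_zero, h3, mul_zero, mul_zero]
  · rw [abs_of_pos hβ, inv_mul_cancel₀ hβ.ne', one_smul]

end

end SliceRegular

namespace SliceRegular

/-! Put `a = Re q₀`, `b = |Im q₀|`. On every slice `Δ` reads `(z - a)² + b²`, whose fibre over `w`
near `0` is the pair `a ± i √(b² - w)`. Splitting a holomorphic `g` into even and odd parts under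
the swap of these roots gives `g = p(Δ) + (z - a) q(Δ)`, and Taylor series of `p`, `q` give `g = ∑
Δⁿ (Aₙ + (z - a) Bₙ)` (`exists_complex_expansion`). Since `Δ' = 2(z - a)` and `(z - a)² = Δ - b²`,
`g'` has such an expansion with explicit coefficients.

For coordinates of a stem function the coefficients can be taken real, so they recombine into
quaternions valid on all slices at once (`exists_stem_expansion`). Writing `x - a = (x - q₀) + Im
q₀` gives `s₂ₙ = Aₙ + Im(q₀) Bₙ` and `s₂ₙ₊₁ = Bₙ`; the formulas then follow from `Im(q₀)² = -b²` and
uniqueness (`isSphericalCoeffs_unique`). -/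

/-! ### Holomorphic functions near a conjugate pair of points -/

theorem exists_sqrt_near_sq (b : ℝ) :
    ∃ s : ℂ → ℂ, DifferentiableOn ℂ s (Metric.ball 0 (b ^ 2)) ∧
      ∀ w ∈ Metric.ball (0 : ℂ) (b ^ 2), s w ^ 2 = (b : ℂ) ^ 2 - w ∧ s w ≠ 0 := by
  -- On this ball `b² - w` stays in the right half-plane, where the principal square root is
  -- holomorphic and nonzero.
  have hre : ∀ w ∈ Metric.ball (0 : ℂ) (b ^ 2), 0 < ((b : ℂ) ^ 2 - w).re := by
    intro w hw
    have h1 : w.re < b ^ 2 :=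
      (Complex.re_le_norm w).trans_lt (by simpa using hw)
    have h2 : ((b : ℂ) ^ 2 - w).re = b ^ 2 - w.re := by
      rw [Complex.sub_re, ← Complex.ofReal_pow, Complex.ofReal_re]
    rw [h2]
    linarith
  refine ⟨fun w => ((b : ℂ) ^ 2 - w) ^ (1 / 2 : ℂ), ?_, fun w hw => ?_⟩
  · intro w hw
    refine DifferentiableAt.differentiableWithinAt ?_
    exact DifferentiableAt.cpow (by fun_prop) (by fun_prop) (Or.inl (hre w hw))
  · have hne : (b : ℂ) ^ 2 - w ≠ 0 := fun h => by
      have := hre w hw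
      rw [h] at this
      simp at this
    have hsq : (((b : ℂ) ^ 2 - w) ^ (1 / 2 : ℂ)) ^ 2 = (b : ℂ) ^ 2 - w := by
      rw [← Complex.cpow_nat_mul]
      norm_num
    refine ⟨hsq, fun h => hne ?_⟩
    rw [← hsq]
    simp only at h
    rw [h]
    norm_num

/-- Near a conjugate pair of points, every holomorphic function is `p (Δ z) + (z - a) q (Δ z)`
with `Δ z = (z - a)² + b²` and `p`, `q` holomorphic. -/
theorem exists_holomorphic_decomposition {D : Set ℂ} (hDo : IsOpen D) (hDc : ConjInvariant D)
    {a b : ℝ} (hb : b ≠ 0) (hz : (⟨a, b⟩ : ℂ) ∈ D) :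
    ∃ r : ℝ, 0 < r ∧ (∀ z : ℂ, ‖(z - a) ^ 2 + (b : ℂ) ^ 2‖ < r → z ∈ D) ∧
      ∀ g : ℂ → ℂ, DifferentiableOn ℂ g D → ∃ p q : ℂ → ℂ,
        DifferentiableOn ℂ p (Metric.ball 0 r) ∧ DifferentiableOn ℂ q (Metric.ball 0 r) ∧
        ∀ z : ℂ, ‖(z - a) ^ 2 + (b : ℂ) ^ 2‖ < r →
          g z = p ((z - a) ^ 2 + (b : ℂ) ^ 2) + (z - a) * q ((z - a) ^ 2 + (b : ℂ) ^ 2) := by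
  obtain ⟨s, hsd, hs⟩ := exists_sqrt_near_sq b
  have hb2 : 0 < b ^ 2 := by positivity
  have h0 : (0 : ℂ) ∈ Metric.ball (0 : ℂ) (b ^ 2) := Metric.mem_ball_self hb2
  have hsc : ContinuousAt s 0 :=
    (hsd.differentiableAt (Metric.isOpen_ball.mem_nhds h0)).continuousAt
  have hz' : (⟨a, -b⟩ : ℂ) ∈ D := hDc _ hz
  have e1 : (⟨a, b⟩ : ℂ) = a + Complex.I * b := by
    apply Complex.ext <;> simp
  have e2 : (⟨a, -b⟩ : ℂ) = a - Complex.I * b := by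
    apply Complex.ext <;> simp
  rw [e1] at hz
  rw [e2] at hz'
  -- Only `s 0 = ± b` is known; conjugation invariance of `D` makes the sign irrelevant.
  have hmem : (a : ℂ) + Complex.I * s 0 ∈ D ∧ (a : ℂ) - Complex.I * s 0 ∈ D := by
    have h := (hs 0 h0).1
    rw [sub_zero, sq_eq_sq_iff_eq_or_eq_neg] at h
    rcases h with h | h <;> rw [h]
    · exact ⟨hz, hz'⟩
    · rw [mul_neg, sub_neg_eq_add, ← sub_eq_add_neg]
      exact ⟨hz', hz⟩
  have ev1 : ∀ᶠ w in nhds (0 : ℂ), (a : ℂ) + Complex.I * s w ∈ D :=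
    (continuousAt_const.add (continuousAt_const.mul hsc)).eventually (hDo.mem_nhds hmem.1)
  have ev2 : ∀ᶠ w in nhds (0 : ℂ), (a : ℂ) - Complex.I * s w ∈ D :=
    (continuousAt_const.sub (continuousAt_const.mul hsc)).eventually (hDo.mem_nhds hmem.2)
  obtain ⟨r, hr, hball⟩ := Metric.eventually_nhds_iff_ball.1
    ((ev1.and ev2).and (Metric.isOpen_ball.mem_nhds h0))
  have hroot : ∀ z : ℂ, ‖(z - a) ^ 2 + (b : ℂ) ^ 2‖ < r →
      z = a + Complex.I * s ((z - a) ^ 2 + (b : ℂ) ^ 2) ∨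
        z = a - Complex.I * s ((z - a) ^ 2 + (b : ℂ) ^ 2) := by
    intro z hzr
    have h := (hs _ (hball _ (mem_ball_zero_iff.2 hzr)).2).1
    set w := (z - a) ^ 2 + (b : ℂ) ^ 2 with hw
    have h2 : (z - a) ^ 2 = (Complex.I * s w) ^ 2 := by
      rw [mul_pow, Complex.I_sq, h, hw]
      ring
    rcases sq_eq_sq_iff_eq_or_eq_neg.1 h2 with h3 | h3
    · exact Or.inl (by rw [← h3]; ring)
    · exact Or.inr (by rw [sub_eq_add_neg, ← h3]; ring)
  refine ⟨r, hr, fun z hzr => ?_, fun g hg => ?_⟩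
  · have h := (hball _ (mem_ball_zero_iff.2 hzr)).1
    rcases hroot z hzr with h1 | h1 <;> rw [h1]
    · exact h.1
    · exact h.2
  · have hsd' : DifferentiableOn ℂ s (Metric.ball 0 r) := hsd.mono fun w hw => (hball w hw).2
    have hg1 : DifferentiableOn ℂ (fun w => g (a + Complex.I * s w)) (Metric.ball 0 r) :=
      hg.comp (by fun_prop) fun w hw => (hball w hw).1.1
    have hg2 : DifferentiableOn ℂ (fun w => g (a - Complex.I * s w)) (Metric.ball 0 r) :=
      hg.comp (by fun_prop) fun w hw => (hball w hw).1.2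
    -- Even part of `g` in the two roots, and odd part divided by `z - a = ± i s(w)`. Both are
    -- unchanged when the roots are swapped.
    refine ⟨fun w => (g (a + Complex.I * s w) + g (a - Complex.I * s w)) / 2,
      fun w => (g (a + Complex.I * s w) - g (a - Complex.I * s w)) / (2 * (Complex.I * s w)),
      (hg1.add hg2).div_const 2,
      (hg1.sub hg2).div (by fun_prop) fun w hw => ?_, fun z hzr => ?_⟩
    · have := (hs w (hball w hw).2).2
      simp [this]
    · have hne := (hs _ (hball _ (mem_ball_zero_iff.2 hzr)).2).2
      have hrt := hroot z hzr
      simp only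
      set w := (z - a) ^ 2 + (b : ℂ) ^ 2 with hw
      have hI : Complex.I * s w ≠ 0 := mul_ne_zero Complex.I_ne_zero hne
      generalize Complex.I * s w = t at hrt hI
      rcases hrt with h1 | h1
      · have h2 : z - a = t := by rw [h1]; ring
        rw [h2, h1]
        field_simp
        ring
      · have h2 : z - a = -t := by rw [h1]; ring
        rw [h2, h1]
        field_simp
        ring

/-! ### Expansions in powers of `Δ` and their derivatives -/

theorem hasSum_of_eq {E : Type*} [AddCommMonoid E] [TopologicalSpace E] {u v : ℕ → E} {x y : E}
    (h : HasSum u x) (huv : ∀ n, v n = u n) (hxy : y = x) : HasSum v y := by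
  rw [hxy, funext huv]
  exact h

theorem hasSum_taylorCoeff {p : ℂ → ℂ} {r : ℝ} (hp : DifferentiableOn ℂ p (Metric.ball 0 r))
    {w : ℂ} (hw : ‖w‖ < r) :
    HasSum (fun n : ℕ => w ^ n * (iteratedDeriv n p 0 / n.factorial)) (p w) := by
  have h := Complex.hasSum_taylorSeries_on_ball hp (mem_ball_zero_iff.2 hw)
  refine h.congr_fun ?_
  intro n
  simp only [sub_zero, smul_eq_mul]
  ring

theorem hasSum_deriv_taylorCoeff {p : ℂ → ℂ} {r : ℝ}
    (hp : DifferentiableOn ℂ p (Metric.ball 0 r)) {w : ℂ} (hw : ‖w‖ < r) :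
    HasSum (fun n : ℕ => w ^ n * ((n + 1) * (iteratedDeriv (n + 1) p 0 / (n + 1).factorial)))
      (deriv p w) := by
  refine (hasSum_taylorCoeff (hp.deriv Metric.isOpen_ball) hw).congr_fun fun n => ?_
  rw [iteratedDeriv_succ', Nat.factorial_succ, Nat.cast_mul, Nat.cast_succ]
  have h : (n : ℂ) + 1 ≠ 0 := Nat.cast_add_one_ne_zero n
  have h' : (n.factorial : ℂ) ≠ 0 := Nat.cast_ne_zero.2 n.factorial_ne_zero
  field_simp

theorem hasSum_mul_deriv_taylorCoeff {p : ℂ → ℂ} {r : ℝ}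
    (hp : DifferentiableOn ℂ p (Metric.ball 0 r)) {w : ℂ} (hw : ‖w‖ < r) :
    HasSum (fun n : ℕ => w ^ n * (n * (iteratedDeriv n p 0 / n.factorial)))
      (w * deriv p w) := by
  rw [← hasSum_nat_add_iff' 1]
  simp only [Finset.range_one, Finset.sum_singleton, Nat.cast_zero, zero_mul, mul_zero, sub_zero]
  refine ((hasSum_deriv_taylorCoeff hp hw).mul_left w).congr_fun fun n => ?_
  push_cast
  ring

/-- The coefficients of the derivative of `∑ Δⁿ (Aₙ + (z - a) Bₙ)`, first component. -/
def derivCoeffA {M : Type*} [AddCommGroup M] [Module ℝ M] (b : ℝ) (B : ℕ → M) (n : ℕ) : M :=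
  (2 * n + 1 : ℝ) • B n - (2 * b ^ 2 * (n + 1) : ℝ) • B (n + 1)

/-- The coefficients of the derivative of `∑ Δⁿ (Aₙ + (z - a) Bₙ)`, second component. -/
def derivCoeffB {M : Type*} [AddCommGroup M] [Module ℝ M] (A : ℕ → M) (n : ℕ) : M :=
  (2 * (n + 1) : ℝ) • A (n + 1)

theorem exists_complex_expansion {g p q : ℂ → ℂ} {a b r : ℝ}
    (hp : DifferentiableOn ℂ p (Metric.ball 0 r)) (hq : DifferentiableOn ℂ q (Metric.ball 0 r))
    (hg : ∀ z : ℂ, ‖(z - a) ^ 2 + (b : ℂ) ^ 2‖ < r →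
      g z = p ((z - a) ^ 2 + (b : ℂ) ^ 2) + (z - a) * q ((z - a) ^ 2 + (b : ℂ) ^ 2)) :
    ∃ A B : ℕ → ℂ, ∀ z : ℂ, ‖(z - a) ^ 2 + (b : ℂ) ^ 2‖ < r →
      HasSum (fun n : ℕ => ((z - a) ^ 2 + (b : ℂ) ^ 2) ^ n * (A n + (z - a) * B n)) (g z) ∧
      HasSum (fun n : ℕ => ((z - a) ^ 2 + (b : ℂ) ^ 2) ^ n *
        (derivCoeffA b B n + (z - a) * derivCoeffB A n)) (deriv g z) := by
  refine ⟨fun n => iteratedDeriv n p 0 / n.factorial, fun n => iteratedDeriv n q 0 / n.factorial,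
    fun z hz => ⟨?_, ?_⟩⟩
  · rw [hg z hz]
    refine ((hasSum_taylorCoeff hp hz).add
      ((hasSum_taylorCoeff hq hz).mul_left (z - a))).congr_fun fun n => ?_
    ring
  · have hU : IsOpen {z : ℂ | ‖(z - a) ^ 2 + (b : ℂ) ^ 2‖ < r} :=
      isOpen_lt (by fun_prop) continuous_const
    have hΔ : HasDerivAt (fun z : ℂ => (z - a) ^ 2 + (b : ℂ) ^ 2) (2 * (z - a)) z := by
      simpa using (((hasDerivAt_id z).sub_const (a : ℂ)).pow 2).add_const ((b : ℂ) ^ 2)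
    have hmem := Metric.isOpen_ball.mem_nhds (mem_ball_zero_iff.2 hz)
    have hdp := (hp.differentiableAt hmem).hasDerivAt.comp z hΔ
    have hdq := (hq.differentiableAt hmem).hasDerivAt.comp z hΔ
    have hd := (hdp.add (((hasDerivAt_id z).sub_const (a : ℂ)).mul hdq)).congr_of_eventuallyEq
      (f₁ := g) (by
        filter_upwards [hU.mem_nhds hz] with y hy
        exact hg y hy)
    rw [hd.deriv]
    -- With `(z - a)² = Δ - b²`, the chain rule reads `g' = q + 2Δ q' - 2b² q' + 2(z - a) p'`, all
    -- evaluated at `Δ`.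
    have h := (((hasSum_taylorCoeff hq hz).add
      ((hasSum_mul_deriv_taylorCoeff hq hz).mul_left 2)).sub
      ((hasSum_deriv_taylorCoeff hq hz).mul_left (2 * (b : ℂ) ^ 2))).add
      ((hasSum_deriv_taylorCoeff hp hz).mul_left (2 * (z - a)))
    refine hasSum_of_eq h (fun n => ?_) ?_
    · simp only [derivCoeffA, derivCoeffB, Complex.real_smul]
      push_cast
      ring
    · simp only [id, Function.comp_apply]
      ring

/-- A holomorphic function commuting with conjugation has an expansion with real coefficients. -/
theorem exists_real_expansion {D : Set ℂ} (hDo : IsOpen D) (hDc : ConjInvariant D)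
    {a b : ℝ} (hb : b ≠ 0) (hz : (⟨a, b⟩ : ℂ) ∈ D) :
    ∃ r : ℝ, 0 < r ∧ (∀ z : ℂ, ‖(z - a) ^ 2 + (b : ℂ) ^ 2‖ < r → z ∈ D) ∧
      ∀ g : ℂ → ℂ, DifferentiableOn ℂ g D →
        (∀ z ∈ D, g (starRingEnd ℂ z) = starRingEnd ℂ (g z)) →
        ∃ A B : ℕ → ℝ, ∀ z : ℂ, ‖(z - a) ^ 2 + (b : ℂ) ^ 2‖ < r →
          HasSum (fun n : ℕ => ((z - a) ^ 2 + (b : ℂ) ^ 2) ^ n *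
            ((A n : ℂ) + (z - a) * (B n : ℂ))) (g z) ∧
          HasSum (fun n : ℕ => ((z - a) ^ 2 + (b : ℂ) ^ 2) ^ n *
            ((derivCoeffA b B n : ℝ) + (z - a) * (derivCoeffB A n : ℝ))) (deriv g z) := by
  obtain ⟨r, hr, hD, hdec⟩ := exists_holomorphic_decomposition hDo hDc hb hz
  refine ⟨r, hr, hD, fun g hg hconj => ?_⟩
  obtain ⟨p, q, hp, hq, hgpq⟩ := hdec g hg
  obtain ⟨A, B, hAB⟩ := exists_complex_expansion hp hq hgpq
  -- Averaging the expansion at `z` with the conjugate of the one at `z̄` replaces each coefficient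
  -- by its real part.
  have key : ∀ (h : ℂ → ℂ) (A B : ℕ → ℂ),
      (∀ z ∈ D, h (starRingEnd ℂ z) = starRingEnd ℂ (h z)) →
      (∀ z : ℂ, ‖(z - a) ^ 2 + (b : ℂ) ^ 2‖ < r →
        HasSum (fun n : ℕ => ((z - a) ^ 2 + (b : ℂ) ^ 2) ^ n * (A n + (z - a) * B n)) (h z)) →
      ∀ z : ℂ, ‖(z - a) ^ 2 + (b : ℂ) ^ 2‖ < r →
        HasSum (fun n : ℕ => ((z - a) ^ 2 + (b : ℂ) ^ 2) ^ n *
          (((A n).re : ℂ) + (z - a) * ((B n).re : ℂ))) (h z) := by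
    intro h A B hh hs z hzr
    have hc : (starRingEnd ℂ z - a) ^ 2 + (b : ℂ) ^ 2
        = starRingEnd ℂ ((z - a) ^ 2 + (b : ℂ) ^ 2) := by
      simp
    have h1 := hs (starRingEnd ℂ z) (by rw [hc, Complex.norm_conj]; exact hzr)
    rw [hc, hh z (hD z hzr)] at h1
    have h2 := Complex.hasSum_conj'.2 h1
    refine hasSum_of_eq (((hs z hzr).add h2).div_const 2) (fun n => ?_) ?_
    · simp only [Complex.re_eq_add_conj, map_mul, map_pow, map_add, map_sub, Complex.conj_conj,
        Complex.conj_ofReal]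
      ring
    · rw [Complex.conj_conj]
      ring
  have hconj' : ∀ z ∈ D, deriv g (starRingEnd ℂ z) = starRingEnd ℂ (deriv g z) := by
    intro z hz
    have hd := (hg.differentiableAt (hDo.mem_nhds hz)).hasDerivAt.conj_conj
    refine (hd.congr_of_eventuallyEq ?_).deriv
    filter_upwards [hDo.mem_nhds (hDc z hz)] with y hy
    have := hconj y hy
    simp only [Function.comp_apply]
    rw [this, Complex.conj_conj]
  refine ⟨fun n => (A n).re, fun n => (B n).re, fun z hzr =>
    ⟨key g A B hconj (fun z hz => (hAB z hz).1) z hzr, ?_⟩⟩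
  refine hasSum_of_eq (key (deriv g) _ _ hconj' (fun z hz => (hAB z hz).2) z hzr)
    (fun n => ?_) rfl
  have h1 : (derivCoeffA b B n).re = derivCoeffA b (fun n => (B n).re) n := by
    simp only [derivCoeffA, Complex.sub_re, Complex.smul_re]
  have h2 : (derivCoeffB A n).re = derivCoeffB (fun n => (A n).re) n := by
    simp only [derivCoeffB, Complex.smul_re]
  rw [h1, h2]

/-- Uniqueness of power series in one real variable: the `cₙ` are the coefficients of a power series
of the zero function. -/
theorem eq_zero_of_hasSum_pow_smul_zero {E : Type*} [NormedAddCommGroup E] [NormedSpace ℝ E]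
    {c : ℕ → E} (h : ∀ᶠ t : ℝ in nhds 0, HasSum (fun n : ℕ => t ^ n • c n) 0) : c = 0 := by
  let p : FormalMultilinearSeries ℝ ℝ E :=
    fun n => ContinuousMultilinearMap.mkPiRing ℝ (Fin n) (c n)
  have hc : ∀ n, p.coeff n = c n := fun n => by simp [FormalMultilinearSeries.coeff, p]
  have hp : HasFPowerSeriesAt (fun _ : ℝ => (0 : E)) p 0 := by
    rw [hasFPowerSeriesAt_iff]
    simpa only [hc] using h
  funext n
  rw [← hc n, hp.eq_zero]
  simp [FormalMultilinearSeries.coeff]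


/-! ### Slices of the quaternions -/

/-- The embedding of `ℂ` into `ℍ` as the slice `ℝ + I ℝ`. -/
def sliceMap {I : ℍ[ℝ]} (hI : I ∈ imagUnits) : ℂ →ₐ[ℝ] ℍ[ℝ] :=
  Complex.liftAux I (mul_self_of_mem hI)

theorem sliceMap_apply {I : ℍ[ℝ]} (hI : I ∈ imagUnits) (z : ℂ) :
    sliceMap hI z = (z.re : ℍ[ℝ]) + I * (z.im : ℍ[ℝ]) := by
  rw [sliceMap, Complex.liftAux_apply, ← Quaternion.coe_commutes, Quaternion.coe_mul_eq_smul]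
  rfl

theorem sliceMap_ofReal {I : ℍ[ℝ]} (hI : I ∈ imagUnits) (t : ℝ) :
    sliceMap hI (t : ℂ) = (t : ℍ[ℝ]) := by
  simp

theorem continuous_sliceMap {I : ℍ[ℝ]} (hI : I ∈ imagUnits) : Continuous (sliceMap hI) :=
  (sliceMap hI).toLinearMap.continuous_of_finiteDimensional

theorem imagUnits_nonempty : imagUnits.Nonempty := ⟨_, i_mem_imagUnits⟩

theorem norm_of_mem_imagUnits {I : ℍ[ℝ]} (hI : I ∈ imagUnits) : ‖I‖ = 1 := by
  have h := congrArg norm (mul_self_of_mem hI)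
  rw [norm_mul, norm_neg, norm_one] at h
  nlinarith [norm_nonneg I]

theorem re_of_mem_imagUnits {I : ℍ[ℝ]} (hI : I ∈ imagUnits) : I.re = 0 := by
  have h1 : I ^ 2 = -1 := hI
  have h2 := norm_of_mem_imagUnits hI
  have h3 : I ^ 2 = -((Quaternion.normSq I : ℝ) : ℍ[ℝ]) := by
    rw [h1, Quaternion.normSq_eq_norm_mul_self, h2]
    simp
  exact Quaternion.sq_eq_neg_normSq.1 h3

theorem re_sliceMap {I : ℍ[ℝ]} (hI : I ∈ imagUnits) (z : ℂ) : (sliceMap hI z).re = z.re := by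
  simp [sliceMap_apply, re_of_mem_imagUnits hI]

theorem im_sliceMap {I : ℍ[ℝ]} (hI : I ∈ imagUnits) (z : ℂ) : (sliceMap hI z).im = z.im • I := by
  rw [sliceMap_apply, ← Quaternion.coe_commutes, Quaternion.coe_mul_eq_smul]
  apply Quaternion.ext <;> simp [re_of_mem_imagUnits hI]

theorem norm_sliceMap {I : ℍ[ℝ]} (hI : I ∈ imagUnits) (z : ℂ) : ‖sliceMap hI z‖ = ‖z‖ := by
  have h2 : Quaternion.normSq I = 1 := by
    rw [Quaternion.normSq_eq_norm_mul_self, norm_of_mem_imagUnits hI, one_mul]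
  rw [Quaternion.normSq_def', re_of_mem_imagUnits hI] at h2
  have h : ‖sliceMap hI z‖ ^ 2 = ‖z‖ ^ 2 := by
    rw [pow_two, ← Quaternion.normSq_eq_norm_mul_self, ← Complex.normSq_eq_norm_sq,
      Quaternion.normSq_def', Complex.normSq_apply]
    simp [sliceMap_apply, re_of_mem_imagUnits hI]
    linear_combination z.im ^ 2 * h2
  exact (sq_eq_sq₀ (norm_nonneg _) (norm_nonneg _)).1 h

theorem mem_circularization_iff {D : Set ℂ} {x : ℍ[ℝ]} :
    x ∈ circularization D ↔ ∃ (z : ℂ) (I : ℍ[ℝ]) (hI : I ∈ imagUnits), z ∈ D ∧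
      x = sliceMap hI z := by
  constructor
  · rintro ⟨α, β, I, hI, hz, rfl⟩
    exact ⟨⟨α, β⟩, I, hI, hz, (sliceMap_apply hI ⟨α, β⟩).symm⟩
  · rintro ⟨z, I, hI, hz, rfl⟩
    exact ⟨z.re, z.im, I, hI, hz, sliceMap_apply hI z⟩

theorem InducesOn.eq_sliceMap {D : Set ℂ} {F : ℂ → HC} {f : ℍ[ℝ] → ℍ[ℝ]} (h : InducesOn D F f)
    {I : ℍ[ℝ]} (hI : I ∈ imagUnits) {z : ℂ} (hz : z ∈ D) :
    f (sliceMap hI z) = (F z).1 + I * (F z).2 := by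
  rw [sliceMap_apply]
  exact h z.re z.im I hI hz

theorem exists_eq_sliceMap (x : ℍ[ℝ]) :
    ∃ (I : ℍ[ℝ]) (hI : I ∈ imagUnits), x = sliceMap hI ⟨x.re, ‖x.im‖⟩ := by
  -- A real point lies on every slice, so any unit serves there.
  by_cases hx : x.im = 0
  · obtain ⟨I, hI⟩ := imagUnits_nonempty
    refine ⟨I, hI, ?_⟩
    rw [sliceMap_apply, hx]
    conv_lhs => rw [← Quaternion.re_add_im x, hx]
    simp
  · have hn : ‖x.im‖ ≠ 0 := norm_ne_zero_iff.2 hx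
    have hI : ‖x.im‖⁻¹ • x.im ∈ imagUnits := by
      change (‖x.im‖⁻¹ • x.im) ^ 2 = -1
      rw [smul_pow, Quaternion.im_sq, Quaternion.normSq_eq_norm_mul_self, smul_neg,
        ← Quaternion.coe_smul, smul_eq_mul, inv_pow, ← pow_two,
        inv_mul_cancel₀ (pow_ne_zero 2 hn), Quaternion.coe_one]
    refine ⟨_, hI, ?_⟩
    rw [sliceMap_apply]
    conv_lhs => rw [← Quaternion.re_add_im x]
    rw [← Quaternion.coe_commutes, Quaternion.coe_mul_eq_smul, smul_smul, mul_inv_cancel₀ hn,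
      one_smul]

theorem mem_of_mem_circularization {D : Set ℂ} (hDc : ConjInvariant D) {x : ℍ[ℝ]}
    (hx : x ∈ circularization D) : (⟨x.re, ‖x.im‖⟩ : ℂ) ∈ D := by
  obtain ⟨z, I, hI, hz, rfl⟩ := mem_circularization_iff.1 hx
  rw [re_sliceMap, im_sliceMap, norm_smul, norm_of_mem_imagUnits hI, mul_one, Real.norm_eq_abs]
  rcases abs_choice z.im with h | h <;> rw [h]
  · exact hz
  · exact hDc z hz

theorem charPoly_eq (q₀ x : ℍ[ℝ]) :
    charPoly q₀ x = (x - (q₀.re : ℍ[ℝ])) ^ 2 + (‖q₀.im‖ : ℍ[ℝ]) ^ 2 := by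
  have h : ((Quaternion.normSq q₀ : ℝ) : ℍ[ℝ]) = (q₀.re : ℍ[ℝ]) ^ 2 + (‖q₀.im‖ : ℍ[ℝ]) ^ 2 := by
    rw [← Quaternion.coe_pow, ← Quaternion.coe_pow, ← Quaternion.coe_add, pow_two ‖q₀.im‖,
      ← Quaternion.normSq_eq_norm_mul_self, Quaternion.normSq_def', Quaternion.normSq_def']
    simp [add_assoc]
  rw [charPoly, Quaternion.self_mul_star, Quaternion.self_add_star, h, two_mul, mul_add]
  have hc : (q₀.re : ℍ[ℝ]) * x = x * (q₀.re : ℍ[ℝ]) := Quaternion.coe_commutes _ _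
  rw [sq (x - _), sub_mul, mul_sub, mul_sub, hc, sq, sq (q₀.re : ℍ[ℝ])]
  abel

theorem charPoly_sliceMap (q₀ : ℍ[ℝ]) {I : ℍ[ℝ]} (hI : I ∈ imagUnits) (z : ℂ) :
    charPoly q₀ (sliceMap hI z) = sliceMap hI ((z - q₀.re) ^ 2 + (‖q₀.im‖ : ℂ) ^ 2) := by
  rw [charPoly_eq, map_add, map_pow, map_pow, map_sub, sliceMap_ofReal, sliceMap_ofReal]

/-! ### Coordinates and expansion of stem functions -/

/-- The complex coordinate `L F₀ + i L F₁` of an element of `ℍ ⊗ ℂ`. -/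
noncomputable def coordC (L : ℍ[ℝ] →L[ℝ] ℝ) : HC →L[ℝ] ℂ :=
  (Complex.equivRealProdCLM.symm : ℝ × ℝ →L[ℝ] ℂ).comp (L.prodMap L)

theorem coordC_apply (L : ℍ[ℝ] →L[ℝ] ℝ) (w : HC) : coordC L w = ⟨L w.1, L w.2⟩ := rfl

theorem fderiv_I_of_dzbar_eq_zero {F : ℂ → HC} {z : ℂ} (h : dzbar F z = 0) :
    fderiv ℝ F z Complex.I = HC.mulI (fderiv ℝ F z 1) := by
  have h1 := (smul_eq_zero.1 h).resolve_left (by norm_num)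
  have h2 := congrArg Prod.fst h1
  have h3 := congrArg Prod.snd h1
  simp only [HC.mulI, Prod.fst_add, Prod.snd_add, Prod.fst_zero, Prod.snd_zero] at h2 h3
  refine Prod.ext ?_ ?_
  · exact (neg_eq_of_add_eq_zero_right h3).symm
  · exact (add_neg_eq_zero.1 h2).symm

theorem dz_of_dzbar_eq_zero {F : ℂ → HC} {z : ℂ} (h : dzbar F z = 0) :
    dz F z = fderiv ℝ F z 1 := by
  rw [dz, fderiv_I_of_dzbar_eq_zero h]
  have : HC.mulI (HC.mulI (fderiv ℝ F z 1)) = -fderiv ℝ F z 1 := rfl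
  rw [this, sub_neg_eq_add, ← two_smul ℝ, smul_smul]
  norm_num

/-- The Cauchy–Riemann equation makes the real differential of each coordinate complex linear, as
its value at `i` is `i` times its value at `1`. -/
theorem hasDerivAt_coordC (L : ℍ[ℝ] →L[ℝ] ℝ) {F : ℂ → HC} {z : ℂ}
    (hF : DifferentiableAt ℝ F z) (h : dzbar F z = 0) :
    HasDerivAt (fun z => coordC L (F z)) (coordC L (dz F z)) z := by
  have h1 : HasFDerivAt (fun z => coordC L (F z)) ((coordC L).comp (fderiv ℝ F z)) z :=
    (coordC L).hasFDerivAt.comp z hF.hasFDerivAt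
  refine hasFDerivAt_of_restrictScalars ℝ h1 ?_
  have hI : coordC L (fderiv ℝ F z Complex.I) = Complex.I * coordC L (fderiv ℝ F z 1) := by
    rw [fderiv_I_of_dzbar_eq_zero h]
    apply Complex.ext <;> simp [coordC_apply, HC.mulI]
  rw [dz_of_dzbar_eq_zero h]
  ext w
  have hw : w = w.re • (1 : ℂ) + w.im • Complex.I := by
    apply Complex.ext <;> simp
  conv_rhs => rw [hw]
  simp only [ContinuousLinearMap.comp_apply, map_add, map_smul, hI]
  apply Complex.ext <;> simp [sub_eq_add_neg]

theorem HolomorphicOn.differentiableAt {D : Set ℂ} (hDo : IsOpen D) {F : ℂ → HC}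
    (hF : HolomorphicOn D F) {z : ℂ} (hz : z ∈ D) : DifferentiableAt ℝ F z :=
  (hF.1.differentiableOn (by norm_num)).differentiableAt (hDo.mem_nhds hz)

/-- Quaternionic expansion of a holomorphic stem function and its derivative. -/
theorem exists_stem_expansion {D : Set ℂ} (hDo : IsOpen D) (hDc : ConjInvariant D)
    {F : ℂ → HC} (hs : IsStemOn D F) (hF : HolomorphicOn D F)
    {a b : ℝ} (hb : b ≠ 0) (hz : (⟨a, b⟩ : ℂ) ∈ D) :
    ∃ r : ℝ, 0 < r ∧ (∀ z : ℂ, ‖(z - a) ^ 2 + (b : ℂ) ^ 2‖ < r → z ∈ D) ∧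
      ∃ A B : ℕ → ℍ[ℝ], ∀ (I : ℍ[ℝ]) (hI : I ∈ imagUnits) (z : ℂ),
        ‖(z - a) ^ 2 + (b : ℂ) ^ 2‖ < r →
        HasSum (fun n : ℕ => sliceMap hI ((z - a) ^ 2 + (b : ℂ) ^ 2) ^ n *
          (A n + sliceMap hI (z - a) * B n)) ((F z).1 + I * (F z).2) ∧
        HasSum (fun n : ℕ => sliceMap hI ((z - a) ^ 2 + (b : ℂ) ^ 2) ^ n *
          (derivCoeffA b B n + sliceMap hI (z - a) * derivCoeffB A n))
          ((dz F z).1 + I * (dz F z).2) := by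
  obtain ⟨r, hr, hD, hexp⟩ := exists_real_expansion hDo hDc hb hz
  refine ⟨r, hr, hD, ?_⟩
  -- Each real coordinate of `F` is a complex function commuting with conjugation. Its coefficients
  -- are real, so `sliceMap` fixes them whatever `I` is, and they do not depend on the slice.
  let e := Module.finBasis ℝ ℍ[ℝ]
  let L := fun k => LinearMap.toContinuousLinearMap (e.coord k)
  have hder : ∀ k, ∀ z ∈ D,
      HasDerivAt (fun z => coordC (L k) (F z)) (coordC (L k) (dz F z)) z := fun k z hz =>
    hasDerivAt_coordC (L k) (hF.differentiableAt hDo hz) (hF.2 z hz)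
  have hex := fun k => hexp (fun z => coordC (L k) (F z))
    (fun z hz => (hder k z hz).differentiableAt.differentiableWithinAt) (by
      intro z hz
      rw [hs z hz]
      apply Complex.ext <;> simp [coordC_apply, HC.conj])
  choose A B hAB using hex
  have hsum : ∀ (I : ℍ[ℝ]) (hI : I ∈ imagUnits) (w : HC),
      ∑ k, sliceMap hI (coordC (L k) w) * e k = w.1 + I * w.2 := by
    intro I hI w
    have hrep : ∀ u : ℍ[ℝ], ∑ k, L k u • e k = u := fun u => e.sum_repr u
    conv_rhs => rw [← hrep w.1, ← hrep w.2]
    rw [Finset.mul_sum, ← Finset.sum_add_distrib]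
    refine Finset.sum_congr rfl fun k _ => ?_
    rw [sliceMap_apply, coordC_apply, add_mul, mul_assoc, Quaternion.coe_mul_eq_smul,
      Quaternion.coe_mul_eq_smul]
  have hpush : ∀ (I : ℍ[ℝ]) (hI : I ∈ imagUnits) (w v : ℂ) (W : HC) (α β : _ → ℕ → ℝ),
      (∀ k, HasSum (fun n : ℕ => w ^ n * ((α k n : ℂ) + v * (β k n : ℂ))) (coordC (L k) W)) →
      HasSum (fun n : ℕ => sliceMap hI w ^ n *
        (∑ k, α k n • e k + sliceMap hI v * ∑ k, β k n • e k)) (W.1 + I * W.2) := by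
    intro I hI w v W α β h
    rw [← hsum I hI W]
    refine hasSum_of_eq (hasSum_sum fun k _ =>
      ((h k).map (sliceMap hI) (continuous_sliceMap hI)).mul_right (e k)) (fun n => ?_) rfl
    rw [Finset.mul_sum, ← Finset.sum_add_distrib, Finset.mul_sum]
    refine Finset.sum_congr rfl fun k _ => ?_
    simp only [Function.comp_apply, map_mul, map_pow, map_add, sliceMap_ofReal]
    rw [mul_assoc, add_mul, mul_assoc, Quaternion.coe_mul_eq_smul, Quaternion.coe_mul_eq_smul]
  refine ⟨fun n => ∑ k, A k n • e k, fun n => ∑ k, B k n • e k, fun I hI z hzr => ⟨?_, ?_⟩⟩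
  · exact hpush I hI _ _ _ A B fun k => (hAB k z hzr).1
  · refine hasSum_of_eq (hpush I hI ((z - a) ^ 2 + (b : ℂ) ^ 2) (z - a) (dz F z) (fun k => derivCoeffA b (B k))
      (fun k => derivCoeffB (A k)) fun k => ?_) (fun n => ?_) rfl
    · have h := (hAB k z hzr).2
      rwa [(hder k z (hD z hzr)).deriv] at h
    · simp only [derivCoeffA, derivCoeffB, Finset.smul_sum, sub_smul, Finset.sum_sub_distrib,
        smul_smul, smul_eq_mul]

/-! ### Spherical coefficients: existence and uniqueness -/

theorem norm_im_sq_smul (q u : ℍ[ℝ]) : ‖q.im‖ ^ 2 • u = -(q.im * (q.im * u)) := by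
  rw [← mul_assoc, ← pow_two, Quaternion.im_sq, neg_mul, neg_neg,
    Quaternion.normSq_eq_norm_mul_self, Quaternion.coe_mul_eq_smul, pow_two]

/-- The sequence interleaving `Aₙ + Im q₀ Bₙ` and `Bₙ`. -/
noncomputable def sphericalSeq (q₀ : ℍ[ℝ]) (A B : ℕ → ℍ[ℝ]) (m : ℕ) : ℍ[ℝ] :=
  if Even m then A (m / 2) + q₀.im * B (m / 2) else B (m / 2)

theorem sphericalSeq_even (q₀ : ℍ[ℝ]) (A B : ℕ → ℍ[ℝ]) (n : ℕ) :
    sphericalSeq q₀ A B (2 * n) = A n + q₀.im * B n := by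
  simp [sphericalSeq]

theorem sphericalSeq_odd (q₀ : ℍ[ℝ]) (A B : ℕ → ℍ[ℝ]) (n : ℕ) :
    sphericalSeq q₀ A B (2 * n + 1) = B n := by
  have h : (2 * n + 1) / 2 = n := by omega
  simp [sphericalSeq, h]

/-- Recentring by `x - Re q₀ = (x - q₀) + Im q₀` turns `Aₙ + (x - Re q₀) Bₙ` into the spherical
form. The radius is `√r` because Cassini balls are cut out by `R²`. -/
theorem isSphericalCoeffs_sphericalSeq {D : Set ℂ} {G : ℂ → HC} {g : ℍ[ℝ] → ℍ[ℝ]}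
    {q₀ : ℍ[ℝ]} {r : ℝ} (hr : 0 < r)
    (hD : ∀ z : ℂ, ‖(z - q₀.re) ^ 2 + (‖q₀.im‖ : ℂ) ^ 2‖ < r → z ∈ D)
    (hg : InducesOn D G g) {A B : ℕ → ℍ[ℝ]}
    (h : ∀ (I : ℍ[ℝ]) (hI : I ∈ imagUnits) (z : ℂ),
      ‖(z - q₀.re) ^ 2 + (‖q₀.im‖ : ℂ) ^ 2‖ < r →
      HasSum (fun n : ℕ => sliceMap hI ((z - q₀.re) ^ 2 + (‖q₀.im‖ : ℂ) ^ 2) ^ n *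
        (A n + sliceMap hI (z - q₀.re) * B n)) ((G z).1 + I * (G z).2)) :
    IsSphericalCoeffs (circularization D) g q₀ (sphericalSeq q₀ A B) := by
  have hx : ∀ x ∈ cassiniBall q₀ (Real.sqrt r), ∃ (I : ℍ[ℝ]) (hI : I ∈ imagUnits) (z : ℂ),
      ‖(z - q₀.re) ^ 2 + (‖q₀.im‖ : ℂ) ^ 2‖ < r ∧ x = sliceMap hI z := by
    intro x hx
    obtain ⟨I, hI, hxI⟩ := exists_eq_sliceMap x
    refine ⟨I, hI, _, ?_, hxI⟩
    have h1 : ‖charPoly q₀ x‖ < Real.sqrt r ^ 2 := hx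
    rw [Real.sq_sqrt hr.le, hxI, charPoly_sliceMap, norm_sliceMap] at h1
    exact h1
  refine ⟨Real.sqrt r, Real.sqrt_pos.2 hr, fun x hxm => ?_, fun x hxm => ?_⟩
  · obtain ⟨I, hI, z, hz, rfl⟩ := hx x hxm
    exact mem_circularization_iff.2 ⟨z, I, hI, hD z hz, rfl⟩
  · obtain ⟨I, hI, z, hz, rfl⟩ := hx x hxm
    rw [hg.eq_sliceMap hI (hD z hz)]
    refine hasSum_of_eq (h I hI z hz) (fun n => ?_) rfl
    rw [charPoly_sliceMap, sphericalSeq_even, sphericalSeq_odd, map_sub, sliceMap_ofReal]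
    congr 1
    conv_lhs => enter [2, 1, 2]; rw [← Quaternion.re_add_im q₀]
    rw [← sub_sub, sub_mul _ q₀.im]
    abel

/-- At the points `Re q₀ ± v I` with `v = √(|Im q₀|² - y)`, `Δ` takes the real value `y`.
Subtracting the two relations isolates the odd coefficients in a power series in `y`; the even ones
follow. -/
theorem isSphericalCoeffs_unique {Ω : Set ℍ[ℝ]} {g : ℍ[ℝ] → ℍ[ℝ]} {q₀ : ℍ[ℝ]}
    (hq : q₀.im ≠ 0) {s t : ℕ → ℍ[ℝ]} (hs : IsSphericalCoeffs Ω g q₀ s)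
    (ht : IsSphericalCoeffs Ω g q₀ t) : s = t := by
  obtain ⟨R₁, hR₁, -, h₁⟩ := hs
  obtain ⟨R₂, hR₂, -, h₂⟩ := ht
  have hb : 0 < ‖q₀.im‖ := norm_pos_iff.2 hq
  have hsmall : ∀ᶠ y : ℝ in nhds 0, |y| < R₁ ^ 2 ∧ |y| < R₂ ^ 2 ∧ |y| < ‖q₀.im‖ ^ 2 := by
    have h : ∀ c : ℝ, 0 < c → ∀ᶠ y : ℝ in nhds 0, |y| < c := fun c hc => by
      filter_upwards [Metric.ball_mem_nhds (0 : ℝ) hc] with y hy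
      rwa [mem_ball_zero_iff, Real.norm_eq_abs] at hy
    exact (h _ (by positivity)).and ((h _ (by positivity)).and (h _ (by positivity)))
  let d : ℕ → ℍ[ℝ] := fun n => s n - t n
  have hslice : ∀ (y : ℝ), |y| < R₁ ^ 2 → |y| < R₂ ^ 2 → |y| < ‖q₀.im‖ ^ 2 →
      ∀ I ∈ imagUnits, HasSum (fun n : ℕ => y ^ n • (d (2 * n) +
        (Real.sqrt (‖q₀.im‖ ^ 2 - y) • I - q₀.im) * d (2 * n + 1))) 0 := by
    intro y hy₁ hy₂ hy₃ I hI
    have hroot := Real.sq_sqrt (sub_nonneg.2 ((le_abs_self y).trans hy₃.le))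
    set v := Real.sqrt (‖q₀.im‖ ^ 2 - y) with hv
    have hΔ : charPoly q₀ (sliceMap hI ⟨q₀.re, v⟩) = (y : ℍ[ℝ]) := by
      rw [charPoly_sliceMap, ← sliceMap_ofReal hI]
      congr 1
      have h1 : (⟨q₀.re, v⟩ : ℂ) - q₀.re = v * Complex.I := by
        apply Complex.ext <;> simp
      rw [h1, mul_pow, Complex.I_sq, ← Complex.ofReal_pow, hroot]
      push_cast
      ring
    have hn : ‖charPoly q₀ (sliceMap hI ⟨q₀.re, v⟩)‖ = |y| := by
      rw [hΔ, Quaternion.norm_coe, Real.norm_eq_abs]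
    have hx : sliceMap hI ⟨q₀.re, v⟩ - q₀ = v • I - q₀.im := by
      rw [sliceMap_apply, ← Quaternion.coe_commutes, Quaternion.coe_mul_eq_smul]
      conv_lhs => enter [2]; rw [← Quaternion.re_add_im q₀]
      abel
    have h := (h₁ _ (hn.trans_lt hy₁)).sub (h₂ _ (hn.trans_lt hy₂))
    refine hasSum_of_eq h (fun n => ?_) (sub_self _).symm
    rw [hΔ, hx, ← mul_sub, ← Quaternion.coe_pow, Quaternion.coe_mul_eq_smul]
    congr 1
    simp only [d, mul_sub]
    abel
  have hodd : (fun n => d (2 * n + 1)) = 0 := by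
    apply eq_zero_of_hasSum_pow_smul_zero
    filter_upwards [hsmall] with y hy
    obtain ⟨I, hI⟩ := imagUnits_nonempty
    have h := (hslice y hy.1 hy.2.1 hy.2.2 I hI).sub
      (hslice y hy.1 hy.2.1 hy.2.2 (-I) (neg_mem_imagUnits hI))
    have hv : Real.sqrt (‖q₀.im‖ ^ 2 - y) ≠ 0 :=
      (Real.sqrt_pos.2 (sub_pos.2 ((le_abs_self y).trans_lt hy.2.2))).ne'
    set v := Real.sqrt (‖q₀.im‖ ^ 2 - y)
    -- The difference has terms `2v yⁿ I d₂ₙ₊₁`; the factors `-I` and `(2v)⁻¹` strip `I` and `2v`.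
    refine hasSum_of_eq ((h.mul_left (-I)).const_smul ((2 * v)⁻¹)) (fun n => ?_) (by simp)
    generalize d (2 * n) = u
    generalize d (2 * n + 1) = w
    have h1 : y ^ n • (u + (v • I - q₀.im) * w) - y ^ n • (u + (v • -I - q₀.im) * w)
        = (2 * v) • y ^ n • (I * w) := by
      simp only [sub_mul, smul_mul_assoc, neg_mul, smul_neg]
      module
    rw [h1, mul_smul_comm, inv_smul_smul₀ (mul_ne_zero two_ne_zero hv), mul_smul_comm,
      ← mul_assoc, neg_mul, mul_self_of_mem hI, neg_neg, one_mul]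
  have heven : (fun n => d (2 * n)) = 0 := by
    apply eq_zero_of_hasSum_pow_smul_zero
    filter_upwards [hsmall] with y hy
    obtain ⟨I, hI⟩ := imagUnits_nonempty
    refine hasSum_of_eq (hslice y hy.1 hy.2.1 hy.2.2 I hI) (fun n => ?_) rfl
    have : d (2 * n + 1) = 0 := congrFun hodd n
    rw [this, mul_zero, add_zero]
  funext m
  rw [← sub_eq_zero]
  rcases Nat.even_or_odd' m with ⟨n, rfl | rfl⟩
  · exact congrFun heven n
  · exact congrFun hodd n

/-! ### The slice derivative and the coefficient formulas -/

/-- The chosen stem function agrees with `F` on the open set `D`, hence so do the derivatives. -/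
theorem sliceDeriv_inducesOn {D : Set ℂ} (hDo : IsOpen D) (hDc : ConjInvariant D)
    {F : ℂ → HC} {f : ℍ[ℝ] → ℍ[ℝ]} (hs : IsStemOn D F) (hi : InducesOn D F f)
    (hF : HolomorphicOn D F) : InducesOn D (dz F) (sliceDeriv D f) := by
  have hex : ∃ F : ℂ → HC, IsStemOn D F ∧ InducesOn D F f := ⟨F, hs, hi⟩
  have hst : stem D f = hex.choose := dif_pos hex
  have heq : Set.EqOn (stem D f) F D := by
    rw [hst]
    exact stem_unique hex.choose_spec.2 hi
  have hdz : Set.EqOn (dz (stem D f)) (dz F) D := by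
    intro z hz
    have : stem D f =ᶠ[nhds z] F := by
      filter_upwards [hDo.mem_nhds hz] with y hy
      exact heq hy
    rw [dz, dz, this.fderiv_eq]
  -- `induced` samples only `β ≥ 0`, so the other half of each slice needs the conjugation symmetry,
  -- obtained by differentiating `F(z̄) = conj F(z)` in the direction `1`.
  have hstem : IsStemOn D (dz (stem D f)) := by
    intro z hz
    rw [hdz hz, hdz (hDc z hz)]
    have hcz := hDc z hz
    let S : HC →L[ℝ] HC := (ContinuousLinearMap.fst ℝ ℍ[ℝ] ℍ[ℝ]).prod
      (-ContinuousLinearMap.snd ℝ ℍ[ℝ] ℍ[ℝ])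
    have hS : ∀ w, S w = HC.conj w := fun _ => rfl
    rw [dz_of_dzbar_eq_zero (hF.2 z hz), dz_of_dzbar_eq_zero (hF.2 _ hcz)]
    have h1 : HasFDerivAt (fun y => F (starRingEnd ℂ y))
        ((fderiv ℝ F (starRingEnd ℂ z)).comp (Complex.conjCLE : ℂ →L[ℝ] ℂ)) z :=
      (hF.differentiableAt hDo hcz).hasFDerivAt.comp z Complex.conjCLE.hasFDerivAt
    have h2 : HasFDerivAt (fun y => S (F y)) (S.comp (fderiv ℝ F z)) z :=
      S.hasFDerivAt.comp z (hF.differentiableAt hDo hz).hasFDerivAt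
    have h3 : (fun y => F (starRingEnd ℂ y)) =ᶠ[nhds z] fun y => S (F y) := by
      filter_upwards [hDo.mem_nhds hz] with y hy
      exact hs y hy
    have h4 := congrArg (fun T : ℂ →L[ℝ] HC => T 1) (h1.unique (h2.congr_of_eventuallyEq h3))
    simpa [hS] using h4
  intro α β I hI hz
  rw [← hdz hz]
  exact inducesOn_induced hstem α β I hI hz

end SliceRegular

theorem theorem5p1 (D : Set ℂ) (hDo : IsOpen D) (hDc : SliceRegular.ConjInvariant D)
    (f : ℍ[ℝ] → ℍ[ℝ]) (hf : SliceRegular.IsSliceRegularOn D f)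
    (q₀ : ℍ[ℝ]) (hq : q₀ ∈ SliceRegular.circularization D) (hq' : q₀.im ≠ 0) :
    (∃! s : ℕ → ℍ[ℝ],
      SliceRegular.IsSphericalCoeffs (SliceRegular.circularization D) f q₀ s) ∧
    (∃! s' : ℕ → ℍ[ℝ],
      SliceRegular.IsSphericalCoeffs (SliceRegular.circularization D)
        (SliceRegular.sliceDeriv D f) q₀ s') ∧
    ∀ s s' : ℕ → ℍ[ℝ],
      SliceRegular.IsSphericalCoeffs (SliceRegular.circularization D) f q₀ s →
      SliceRegular.IsSphericalCoeffs (SliceRegular.circularization D)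
        (SliceRegular.sliceDeriv D f) q₀ s' →
      ∀ k : ℕ,
        s' (2 * k) = (2 * (k : ℍ[ℝ]) + 1) * s (2 * k + 1)
          + 2 * ((k : ℍ[ℝ]) + 1) * q₀.im * s (2 * k + 2) ∧
        s' (2 * k + 1) = (2 * (k : ℍ[ℝ]) + 2) * s (2 * k + 2)
          - 2 * ((k : ℍ[ℝ]) + 1) * q₀.im * s (2 * k + 3) := by
  obtain ⟨F, hstem, hind, hhol⟩ := hf
  obtain ⟨r, hr, hD, A, B, hAB⟩ := SliceRegular.exists_stem_expansion hDo hDc hstem hhol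
    (norm_ne_zero_iff.2 hq') (SliceRegular.mem_of_mem_circularization hDc hq)
  have h₁ := SliceRegular.isSphericalCoeffs_sphericalSeq hr hD hind
    fun I hI z hz => (hAB I hI z hz).1
  have h₂ := SliceRegular.isSphericalCoeffs_sphericalSeq hr hD
    (SliceRegular.sliceDeriv_inducesOn hDo hDc hstem hind hhol)
    fun I hI z hz => (hAB I hI z hz).2
  refine ⟨⟨_, h₁, fun t ht => SliceRegular.isSphericalCoeffs_unique hq' ht h₁⟩,
    ⟨_, h₂, fun t ht => SliceRegular.isSphericalCoeffs_unique hq' ht h₂⟩,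
    fun s s' hs hs' k => ?_⟩
  rw [SliceRegular.isSphericalCoeffs_unique hq' hs h₁,
    SliceRegular.isSphericalCoeffs_unique hq' hs' h₂, show 2 * k + 3 = 2 * (k + 1) + 1 by ring,
    show 2 * k + 2 = 2 * (k + 1) by ring]
  simp only [SliceRegular.sphericalSeq_even, SliceRegular.sphericalSeq_odd,
    SliceRegular.derivCoeffA, SliceRegular.derivCoeffB]
  have hc₁ : (2 * (k : ℍ[ℝ]) + 1) = ((2 * k + 1 : ℝ) : ℍ[ℝ]) := by push_cast; rfl
  have hc₂ : (2 * (k : ℍ[ℝ]) + 2) = ((2 * (k + 1) : ℝ) : ℍ[ℝ]) := by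
    rw [mul_add, mul_one]
    push_cast
    rfl
  have hc₃ : 2 * ((k : ℍ[ℝ]) + 1) = ((2 * (k + 1) : ℝ) : ℍ[ℝ]) := by push_cast; rfl
  -- Replacing `b²` by `-Im(q₀)²` lets the `Bₖ₊₁` term combine with `Im(q₀) Aₖ₊₁` into `Im(q₀)
  -- s₂ₖ₊₂`.
  rw [hc₁, hc₂, hc₃, mul_right_comm 2 (‖q₀.im‖ ^ 2), mul_smul (2 * ((k : ℝ) + 1)),
    SliceRegular.norm_im_sq_smul]
  simp only [Quaternion.coe_mul_eq_smul, smul_mul_assoc, mul_smul_comm, mul_add,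
    smul_neg]
  constructor <;> abel
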